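/- Throughout, logarithms are to base $2$, $\mu$ is Lebesgue measure on $\mathbb{R}^n$, and entropies take values in the extended real line. **Definitions.** A *randomized quantizer* is a pair $(P_S,Q)$ of a probability distribution $P_S$ on a measurable space $\mathcal{S}$ and a measurable function $Q:\mathbb{R}^n\times\mathcal{S}\to\mathbb{R}^n$ such that $\{Q(x,s):x\in\mathbb{R}^n\}$ is at most countable for every $s\in\mathcal{S}$. For a random input $X$ independent of $S\sim P_S$, $H(Q(X,S)\mid S)\in[0,\infty]$ is the conditional Shannon entropy. The *normalized entropy* of the quantizer is $$\overline{H}(Q):=\limsup_{\tau\to\infty}\big(H(Q(X_\tau,S)\mid S)-\log\mu(\tau B^n)\big),$$ where $B^n$ is the closed Euclidean unit ball and $X_\tau\sim\mathrm{Unif}(\tau B^n)$ is independent of $S\sim P_S$. The *layered entropy* of a probability density function $f:\mathbb{R}^n\to[0,\infty)$ is $$h_L(f):=\int_0^\infty \mu(L_t^+(f))\,\log\mu(L_t^+(f))\,dt,\qquad L_t^+(f):=\{z\in\mathbb{R}^n: f(z)\ge t\},$$ that is, the integral of the positive part of the integrand minus the integral of the negative part, with $0\log 0=0$ and with the value $-\infty$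 if both integrals are infinite. **Theorem.** Let $(P_S,Q)$ be a randomized quantizer on $\mathbb{R}^n$ and let $f:\mathbb{R}^n\to[0,\infty)$ be measurable. 1. Let $\mathcal{X}\subseteq\mathbb{R}^n$ be measurable with $0<\mu(\mathcal{X})<\infty$, and let $X\sim\mathrm{Unif}(\mathcal{X})$ be independent of $S\sim P_S$. If the error $Q(X,S)-X$ has probability density function $f$, then $$H(Q(X,S)\mid S)\ \ge\ \log\mu(\mathcal{X})-h_L(f).$$ 2. If for every $x\in\mathbb{R}^n$ the error $Q(x,S)-x$, with $S\sim P_S$, has probability density function $f$, then $$\overline{H}(Q)\ \ge\ -h_L(f).$$ -/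

import Mathlib

open MeasureTheory ProbabilityTheory Filter
open scoped ENNReal

noncomputable section

/-- A randomized quantizer on `ℝⁿ` with state space `𝒮`: a probability distribution of the
state together with a (jointly measurable) quantization function that, for each fixed state,
takes at most countably many values. -/
structure RandomizedQuantizer (n : ℕ) (𝒮 : Type*) [MeasurableSpace 𝒮] where
  stateLaw : Measure 𝒮
  isProbabilityMeasure_stateLaw : IsProbabilityMeasure stateLaw
  quantize : EuclideanSpace ℝ (Fin n) → 𝒮 → EuclideanSpace ℝ (Fin n)
  measurable_quantize : Measurable (Function.uncurry quantize)
  countable_range : ∀ s : 𝒮, (Set.range fun x => quantize x s).Countable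

attribute [instance] RandomizedQuantizer.isProbabilityMeasure_stateLaw

open Classical in
/-- Shannon entropy in bits of a probability measure: `∑ y, p y * log₂ (1 / p y)` if the measure
is concentrated on a countable set, and `∞` otherwise. -/
def shannonEntropy {𝒴 : Type*} [MeasurableSpace 𝒴] (ν : Measure 𝒴) : ℝ≥0∞ :=
  if ∃ C : Set 𝒴, C.Countable ∧ ν Cᶜ = 0 then
    ∑' y : 𝒴, ENNReal.ofReal (-(ν.real {y} * Real.logb 2 (ν.real {y})))
  else ∞

/-- Conditional Shannon entropy `H(Y | S)` in bits: the average over `s`, with respect to the law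
of `S`, of the entropy of the conditional distribution of `Y` given `S = s`. -/
def condShannonEntropy {Ω 𝒮 𝒴 : Type*} [MeasurableSpace Ω] [MeasurableSpace 𝒮]
    [MeasurableSpace 𝒴] [StandardBorelSpace 𝒴] [Nonempty 𝒴]
    (Y : Ω → 𝒴) (S : Ω → 𝒮) (P : Measure Ω) [IsFiniteMeasure P] : ℝ≥0∞ :=
  ∫⁻ s, shannonEntropy (condDistrib Y S P s) ∂(P.map S)

/-- The integrand `μ(L_t⁺(f)) log₂ μ(L_t⁺(f))` of the layered entropy,
where `L_t⁺(f) = {z | f z ≥ t}` and `μ` is Lebesgue measure. -/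
def layeredIntegrand {n : ℕ} (f : EuclideanSpace ℝ (Fin n) → ℝ) (t : ℝ) : ℝ :=
  volume.real {z | t ≤ f z} * Real.logb 2 (volume.real {z | t ≤ f z})

/-- The layered entropy `h_L(f) = ∫₀^∞ μ(L_t⁺(f)) log₂ μ(L_t⁺(f)) dt` of a probability density
function, as an extended real number: the integral of the positive part minus the integral of
the negative part. If both are infinite, the value is `-∞` (in `EReal`, `⊤ - ⊤ = ⊥`). -/
def layeredEntropy {n : ℕ} (f : EuclideanSpace ℝ (Fin n) → ℝ) : EReal :=
  ((∫⁻ t in Set.Ioi (0 : ℝ), ENNReal.ofReal (layeredIntegrand f t) : ℝ≥0∞) : EReal) -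
    ((∫⁻ t in Set.Ioi (0 : ℝ), ENNReal.ofReal (-layeredIntegrand f t) : ℝ≥0∞) : EReal)

namespace RandomizedQuantizer

/-- `H(Q(X_τ, S) | S)`, where `X_τ` is uniform on the closed ball of radius `τ` around the
origin, and is independent of the state `S`. -/
def ballEntropy {n : ℕ} {𝒮 : Type*} [MeasurableSpace 𝒮] (q : RandomizedQuantizer n 𝒮)
    (τ : ℝ) : ℝ≥0∞ :=
  condShannonEntropy
    (fun ω : EuclideanSpace ℝ (Fin n) × 𝒮 => q.quantize ω.1 ω.2) (fun ω => ω.2)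
    ((ProbabilityTheory.cond volume (Metric.closedBall 0 τ)).prod q.stateLaw)

/-- The normalized entropy
`limsup_{τ → ∞} (H(Q(X_τ, S) | S) - log₂ μ(τ Bⁿ))`, with `X_τ` uniform on `τ Bⁿ`. -/
def normalizedEntropy {n : ℕ} {𝒮 : Type*} [MeasurableSpace 𝒮]
    (q : RandomizedQuantizer n 𝒮) : EReal :=
  limsup (fun τ : ℝ => ((q.ballEntropy τ : ℝ≥0∞) : EReal) -
    ((Real.logb 2 (volume.real
      (Metric.closedBall (0 : EuclideanSpace ℝ (Fin n)) τ)) : ℝ) : EReal)) atTop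

end RandomizedQuantizer

end

/-! Write `m = μ(𝒳)` and `V t = μ {f ≥ t}`. The proof tests the error against functions `0 ≤ g ≤ 1`
with `∫ g ≤ b m`, for `0 < b ≤ 1`. The bathtub principle (`exists_testFunction_lintegral_min_le`)
supplies such a `g` for which the mean of `g` at the error is at least `∫ min (V t) (b m) dt`.
Conversely, fix a state: on a cell of probability `p` the error is a reflected translate of the
input, so the cell contributes at most `min p b`. Summed over cells, the mean is at most the mean of
`min 1 (b / p)`, with `p` the conditional probability of the output
(`lintegral_comp_sub_le_lintegral_min`).

Integrating the comparison against `db / b` over `(0, 1]` produces logarithms: the upper bound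
becomes the mean of `1 + log (1 / p)`, which is at most one plus the conditional entropy in nats,
and the lower bound becomes at least `∫ V (1 + log m - log V) dt`. Since `∫ V dt = ∫ f = 1`, the
ones cancel and `log m - h_L(f) ≤ H` remains. The second claim applies this on each ball and takes
the limsup. -/

/-! ### Bathtub principle -/

/-- The bathtub principle, lower bound: a test function with values in `[0, 1]` and mass at most
`a` captures the truncated layer-cake integral of `f`. -/
theorem exists_testFunction_lintegral_min_le {α : Type*} [MeasurableSpace α] (μ : Measure α)
    {f : α → ℝ} (hf : Measurable f) (hf0 : ∀ z, 0 ≤ f z)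
    (hfi : ∫⁻ z, ENNReal.ofReal (f z) ∂μ ≠ ∞) {a : ℝ≥0∞} (ha : a ≠ 0) :
    ∃ g : α → ℝ≥0∞, Measurable g ∧ (∀ z, g z ≤ 1) ∧ ∫⁻ z, g z ∂μ ≤ a ∧
      ∫⁻ t in Set.Ioi (0 : ℝ), min (μ {z | t ≤ f z}) a ≤ ∫⁻ z, ENNReal.ofReal (f z) * g z ∂μ := by
  have hmeas : ∀ t : ℝ, MeasurableSet {z | t ≤ f z} := fun t => measurableSet_le measurable_const hf
  have hmeas' : ∀ t : ℝ, MeasurableSet {z | t < f z} := fun t => measurableSet_lt measurable_const hf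
  have markov : ∀ t : ℝ, ENNReal.ofReal t * μ {z | t ≤ f z} ≤ ∫⁻ z, ENNReal.ofReal (f z) ∂μ := by
    intro t
    refine le_trans ?_ (mul_meas_ge_le_lintegral (by fun_prop) (ENNReal.ofReal t))
    gcongr
    exact fun hz => ENNReal.ofReal_le_ofReal hz
  have hfin : ∀ t : ℝ, 0 < t → μ {z | t ≤ f z} ≠ ∞ := by
    intro t ht h
    have := markov t
    rw [h, ENNReal.mul_top (by simpa using ht)] at this
    exact hfi (top_le_iff.1 this)
  -- reduction to the existence of a test function that fills each level set
  suffices H : ∃ g : α → ℝ≥0∞, Measurable g ∧ (∀ z, g z ≤ 1) ∧ ∫⁻ z, g z ∂μ ≤ a ∧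
      ∀ t : ℝ, 0 < t → min (μ {z | t ≤ f z}) a ≤ ∫⁻ z in {z | t ≤ f z}, g z ∂μ by
    obtain ⟨g, hg, hg1, hga, hgt⟩ := H
    refine ⟨g, hg, hg1, hga, ?_⟩
    have h1 : ∫⁻ z, ENNReal.ofReal (f z) * g z ∂μ
        = ∫⁻ z, ENNReal.ofReal (f z) ∂(μ.withDensity g) := by
      rw [lintegral_withDensity_eq_lintegral_mul _ hg (by fun_prop)]
      simp [mul_comm]
    rw [h1, lintegral_eq_lintegral_meas_le _ (ae_of_all _ hf0) hf.aemeasurable]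
    refine setLIntegral_mono' measurableSet_Ioi fun t ht => ?_
    rw [withDensity_apply _ (hmeas t)]
    exact hgt t ht
  have above : ∀ t₀ : ℝ, (∀ t, t₀ < t → μ {z | t ≤ f z} ≤ a) → μ {z | t₀ < f z} ≤ a := by
    intro t₀ h
    have : {z | t₀ < f z} = ⋃ k : ℕ, {z | t₀ + 1 / ((k : ℝ) + 1) ≤ f z} := by
      ext z
      simp only [Set.mem_ofPred_eq, Set.mem_iUnion]
      constructor
      · intro hz
        obtain ⟨k, hk⟩ := exists_nat_one_div_lt (sub_pos.2 hz)
        exact ⟨k, by linarith⟩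
      · rintro ⟨k, hk⟩
        have : (0 : ℝ) < 1 / ((k : ℝ) + 1) := by positivity
        linarith
    rw [this, Monotone.measure_iUnion]
    · exact iSup_le fun k => h _ (by linarith [show (0 : ℝ) < 1 / ((k : ℝ) + 1) by positivity])
    · intro i j hij z hz
      simp only [Set.mem_ofPred_eq] at hz ⊢
      have := one_div_le_one_div_of_le (by positivity : (0 : ℝ) < (i : ℝ) + 1)
        (by gcongr : (i : ℝ) + 1 ≤ (j : ℝ) + 1)
      linarith
  by_cases hne : ∃ t : ℝ, 0 < t ∧ a ≤ μ {z | t ≤ f z}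
  swap
  · push Not at hne
    refine ⟨{z | 0 < f z}.indicator 1, measurable_one.indicator (hmeas' 0), fun z => ?_, ?_, ?_⟩
    · exact Set.indicator_le_self' (by simp) z
    · rw [lintegral_indicator_one (hmeas' 0)]
      exact above 0 fun t ht => (hne t ht).le
    · intro t ht
      rw [lintegral_indicator_one (hmeas' 0), Measure.restrict_apply (hmeas' 0),
        Set.inter_eq_right.2
          (show {z | t ≤ f z} ⊆ {z | 0 < f z} from fun z hz => lt_of_lt_of_le ht hz)]
      exact min_le_left _ _
  set T : Set ℝ := {t : ℝ | 0 < t ∧ a ≤ μ {z | t ≤ f z}} with hT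
  have hbdd : BddAbove T := by
    have hatop : a ≠ ∞ := by
      obtain ⟨t, ht, hta⟩ := hne
      exact ne_top_of_le_ne_top (hfin t ht) hta
    -- Markov's inequality gives `t * a ≤ ∫ f` for every `t ∈ T`.
    refine ⟨((∫⁻ z, ENNReal.ofReal (f z) ∂μ) / a).toReal, fun t ht => ?_⟩
    rw [← ENNReal.ofReal_le_iff_le_toReal (ENNReal.div_ne_top hfi ha),
      ENNReal.le_div_iff_mul_le (.inl ha) (.inl hatop)]
    exact le_trans (by gcongr; exact ht.2) (markov t)
  set t₀ : ℝ := sSup T with ht₀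
  have ht₀pos : 0 < t₀ := by
    obtain ⟨t, ht⟩ := hne
    exact lt_of_lt_of_le ht.1 (le_csSup hbdd ht)
  have hgt : ∀ t, t₀ < t → μ {z | t ≤ f z} ≤ a := by
    intro t ht
    by_contra h
    exact absurd (le_csSup hbdd (show t ∈ T from ⟨ht₀pos.trans ht, (not_le.1 h).le⟩)) (not_le.2 ht)
  -- Continuity from above along levels `u k ↑ t₀`; finiteness holds because `u 0 > 0`.
  have hge : a ≤ μ {z | t₀ ≤ f z} := by
    obtain ⟨u, humono, hu, hulim⟩ := exists_seq_strictMono_tendsto' ht₀pos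
    have : {z | t₀ ≤ f z} = ⋂ k, {z | u k ≤ f z} := by
      ext z
      simp only [Set.mem_ofPred_eq, Set.mem_iInter]
      exact ⟨fun hz k => (hu k).2.le.trans hz, fun hz => le_of_tendsto' hulim hz⟩
    rw [this, Antitone.measure_iInter]
    · refine le_iInf fun k => ?_
      obtain ⟨s, hs, hus⟩ := exists_lt_of_lt_csSup hne (hu k).2
      exact hs.2.trans (measure_mono fun z hz => hus.le.trans hz)
    · exact fun i j hij z hz => (humono.monotone hij).trans hz
    · exact fun k => (hmeas _).nullMeasurableSet
    · exact ⟨0, hfin _ (hu 0).1⟩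
  have hA : μ {z | t₀ < f z} ≤ a := above t₀ hgt
  have hE : MeasurableSet {z | f z = t₀} := measurableSet_eq_fun hf measurable_const
  have hsplit : {z | t₀ ≤ f z} = {z | t₀ < f z} ∪ {z | f z = t₀} := by
    ext z; simp [le_iff_lt_or_eq, eq_comm]
  have hdisj : Disjoint {z | t₀ < f z} {z | f z = t₀} :=
    Set.disjoint_left.2 fun z hz hz' => (ne_of_gt hz) hz'
  have hsum : μ {z | t₀ ≤ f z} = μ {z | t₀ < f z} + μ {z | f z = t₀} := by
    rw [hsplit, measure_union hdisj hE]
  have hAfin : μ {z | t₀ < f z} ≠ ∞ :=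
    ne_top_of_le_ne_top (hfin t₀ ht₀pos) (measure_mono fun z (hz : t₀ < f z) => hz.le)
  have hEfin : μ {z | f z = t₀} ≠ ∞ :=
    ne_top_of_le_ne_top (hfin t₀ ht₀pos) (measure_mono fun z hz => ge_of_eq hz)
  have hd : a - μ {z | t₀ < f z} ≤ μ {z | f z = t₀} := by
    rw [tsub_le_iff_left, ← hsum]; exact hge
  -- The level set `{f = t₀}` may have positive mass, and only the fraction `θ` of it is used, so
  -- that `g` has mass exactly `a`. If that level set is null, `hd` makes the numerator zero as
  -- well.
  set θ : ℝ≥0∞ := (a - μ {z | t₀ < f z}) / μ {z | f z = t₀} with hθ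
  have hθ1 : θ ≤ 1 := ENNReal.div_le_of_le_mul (by simpa using hd)
  have hθmul : θ * μ {z | f z = t₀} = a - μ {z | t₀ < f z} := by
    by_cases h0 : μ {z | f z = t₀} = 0
    · rw [h0] at hd ⊢
      simp only [mul_zero]
      exact (le_antisymm hd zero_le).symm
    · exact ENNReal.div_mul_cancel h0 hEfin
  set g : α → ℝ≥0∞ := fun z => {z | t₀ < f z}.indicator 1 z + {z | f z = t₀}.indicator (fun _ => θ) z
    with hg
  have hgm : Measurable g :=
    (measurable_one.indicator (hmeas' t₀)).add (measurable_const.indicator hE)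
  have hgint : ∫⁻ z, g z ∂μ = a := by
    rw [hg, lintegral_add_left (measurable_one.indicator (hmeas' t₀)),
      lintegral_indicator_one (hmeas' t₀), lintegral_indicator_const hE, hθmul]
    exact add_tsub_cancel_of_le hA
  refine ⟨g, hgm, fun z => ?_, hgint.le, fun t ht => ?_⟩
  · by_cases hz : z ∈ {z | t₀ < f z}
    · have hz' : z ∉ {z | f z = t₀} := Set.disjoint_left.1 hdisj hz
      simp only [hg, Set.indicator_of_mem hz, Set.indicator_of_notMem hz']
      simp
    · simp only [hg, Set.indicator_of_notMem hz, zero_add]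
      exact (Set.indicator_le_self' (by simp) z).trans hθ1
  -- Below `t₀` the whole support of `g` lies in `{t ≤ f}`, giving mass `a`; above `t₀`, `g = 1` on
  -- `{t ≤ f}`.
  · rcases le_or_gt t t₀ with htt | htt
    · refine (min_le_right _ _).trans (hgint.ge.trans_eq ?_)
      rw [← lintegral_indicator (hmeas t)]
      refine lintegral_congr fun z => ?_
      by_cases hz : z ∈ {z | t ≤ f z}
      · rw [Set.indicator_of_mem hz]
      · have hz1 : f z < t := not_le.1 hz
        have h1 : z ∉ {z | t₀ < f z} := fun h => absurd (lt_trans h hz1) (not_lt.2 htt)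
        have h2 : z ∉ {z | f z = t₀} := fun h => absurd (h ▸ hz1) (not_lt.2 htt)
        rw [Set.indicator_of_notMem hz]
        simp only [hg, Set.indicator_of_notMem h1, Set.indicator_of_notMem h2, add_zero]
    · refine (min_le_left _ _).trans (le_of_eq ?_)
      rw [← setLIntegral_one]
      refine setLIntegral_congr_fun (hmeas t) fun z hz => ?_
      have h1 : z ∈ {z | t₀ < f z} := lt_of_lt_of_le htt hz
      have h2 : z ∉ {z | f z = t₀} := Set.disjoint_left.1 hdisj h1
      simp only [hg, Set.indicator_of_mem h1, Set.indicator_of_notMem h2, add_zero, Pi.one_apply]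

/-! ### Logarithms from truncations -/

/-- The truncation integral `∫₀¹ min(v, b m) db / b`; for `0 < v ≤ m` it equals
`v (1 + log (m / v))`. -/
noncomputable def truncationIntegral (v m : ℝ≥0∞) : ℝ≥0∞ :=
  ∫⁻ b in Set.Ioc (0 : ℝ) 1, min v (ENNReal.ofReal b * m) * ENNReal.ofReal b⁻¹

/-- The two terms of the minimum cross at `b = 1 / c`: the integrand is `c` before, contributing
`1`, and `1 / b` after, contributing `log c`. -/
theorem truncationIntegral_one_le {c : ℝ} (hc : 1 ≤ c) :
    truncationIntegral 1 (ENNReal.ofReal c) = ENNReal.ofReal (1 + Real.log c) := by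
  have hc0 : 0 < c := by linarith
  have hc1 : c⁻¹ ≤ 1 := inv_le_one_of_one_le₀ hc
  have hci : 0 < c⁻¹ := by positivity
  rw [truncationIntegral, ← Set.Ioc_union_Ioc_eq_Ioc hci.le hc1,
    lintegral_union measurableSet_Ioc (Set.Ioc_disjoint_Ioc_of_le le_rfl),
    ENNReal.ofReal_add zero_le_one (Real.log_nonneg hc)]
  congr 1
  · have : ∀ b ∈ Set.Ioc 0 c⁻¹, min 1 (ENNReal.ofReal b * ENNReal.ofReal c) * ENNReal.ofReal b⁻¹
        = ENNReal.ofReal c := by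
      rintro b ⟨hb0, hb⟩
      have h1 : b * c ≤ 1 := by rwa [← one_div, le_div_iff₀ hc0] at hb
      rw [← ENNReal.ofReal_mul hb0.le, min_eq_right (ENNReal.ofReal_le_one.2 h1),
        ← ENNReal.ofReal_mul (by positivity)]
      congr 1
      field_simp
    rw [setLIntegral_congr_fun measurableSet_Ioc this]
    simp only [lintegral_const, Measure.restrict_apply_univ, Real.volume_Ioc, sub_zero]
    rw [← ENNReal.ofReal_mul hc0.le, mul_inv_cancel₀ hc0.ne']
  · have : ∀ b ∈ Set.Ioc c⁻¹ 1, min 1 (ENNReal.ofReal b * ENNReal.ofReal c) * ENNReal.ofReal b⁻¹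
        = ENNReal.ofReal b⁻¹ := by
      rintro b ⟨hb, hb1⟩
      have hb0 : 0 < b := hci.trans hb
      have h1 : 1 ≤ b * c := by
        rw [inv_lt_iff_one_lt_mul₀ hc0] at hb; linarith
      rw [← ENNReal.ofReal_mul hb0.le, min_eq_left (ENNReal.one_le_ofReal.2 h1), one_mul]
    rw [setLIntegral_congr_fun measurableSet_Ioc this,
      ← ofReal_integral_eq_lintegral_ofReal]
    · rw [← intervalIntegral.integral_of_le hc1, integral_inv_of_pos hci one_pos]
      simp
    · rw [← IntegrableOn, ← intervalIntegrable_iff_integrableOn_Ioc_of_le hc1]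
      exact intervalIntegral.intervalIntegrable_inv
        (fun x hx => by
          rw [Set.uIcc_of_le hc1] at hx
          exact (hci.trans_le hx.1).ne') continuousOn_id
    · filter_upwards [ae_restrict_mem measurableSet_Ioc] with b hb
      exact inv_nonneg.2 (hci.trans hb.1).le

/-- For `c ≤ 1` there is no crossing and the integral is `c`, so `log c ≤ c - 1` suffices. -/
theorem ofReal_one_add_log_le_truncationIntegral {c : ℝ} (hc : 0 < c) :
    ENNReal.ofReal (1 + Real.log c) ≤ truncationIntegral 1 (ENNReal.ofReal c) := by
  rcases le_total 1 c with h | h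
  · exact (truncationIntegral_one_le h).ge
  · have : ∀ b ∈ Set.Ioc (0 : ℝ) 1,
        min 1 (ENNReal.ofReal b * ENNReal.ofReal c) * ENNReal.ofReal b⁻¹ = ENNReal.ofReal c := by
      rintro b ⟨hb0, hb⟩
      rw [← ENNReal.ofReal_mul hb0.le,
        min_eq_right (ENNReal.ofReal_le_one.2 (mul_le_one₀ hb hc.le h)),
        ← ENNReal.ofReal_mul (by positivity)]
      congr 1
      field_simp
    rw [truncationIntegral, setLIntegral_congr_fun measurableSet_Ioc this]
    simp only [lintegral_const, Measure.restrict_apply_univ, Real.volume_Ioc, sub_zero,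
      ENNReal.ofReal_one, mul_one]
    exact ENNReal.ofReal_le_ofReal (by linarith [Real.log_le_sub_one_of_pos hc])

/-- Scaling by `v` reduces to `v = 1`. The case `v > m` is needed because superlevel sets of `f` can
be larger than `𝒳`. -/
theorem ofReal_mul_log_div_le_truncationIntegral {v m : ℝ} (hv : 0 ≤ v) (hm : 0 < m) :
    ENNReal.ofReal (v * (1 + (Real.log m - Real.log v))) ≤
      truncationIntegral (ENNReal.ofReal v) (ENNReal.ofReal m) := by
  rcases hv.eq_or_lt with rfl | hv
  · simp
  have : truncationIntegral (ENNReal.ofReal v) (ENNReal.ofReal m)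
      = ENNReal.ofReal v * truncationIntegral 1 (ENNReal.ofReal (m / v)) := by
    rw [truncationIntegral, truncationIntegral, ← lintegral_const_mul' _ _ ENNReal.ofReal_ne_top]
    refine lintegral_congr fun b => ?_
    rw [← mul_assoc, mul_min, mul_one, mul_left_comm, ← ENNReal.ofReal_mul hv.le,
      mul_div_cancel₀ _ hv.ne']
  rw [this, ENNReal.ofReal_mul hv.le, ← Real.log_div hm.ne' hv.ne']
  gcongr
  exact ofReal_one_add_log_le_truncationIntegral (div_pos hm hv)

/-! ### Cells and output entropy for a fixed state -/

/-- If a quantization map `T` with countably many values is applied to a uniform input, then the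
expectation of a test function of mass at most `b μ(𝒳)` of the error is bounded in terms of the
point masses of the output distribution. -/
theorem lintegral_comp_sub_le_lintegral_min {n : ℕ} {𝒳 : Set (EuclideanSpace ℝ (Fin n))}
    (h𝒳0 : volume 𝒳 ≠ 0) (h𝒳 : volume 𝒳 ≠ ∞)
    {T : EuclideanSpace ℝ (Fin n) → EuclideanSpace ℝ (Fin n)} (hT : Measurable T)
    (hTc : (Set.range T).Countable) {g : EuclideanSpace ℝ (Fin n) → ℝ≥0∞}
    (hg1 : ∀ z, g z ≤ 1) {b : ℝ≥0∞} (hgb : ∫⁻ z, g z ≤ b * volume 𝒳) :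
    ∫⁻ x, g (T x - x) ∂(cond volume 𝒳) ≤
      ∫⁻ y, min 1 (b * ((cond volume 𝒳).map T {y})⁻¹) ∂((cond volume 𝒳).map T) := by
  set U : Measure (EuclideanSpace ℝ (Fin n)) := cond volume 𝒳 with hU
  have : IsProbabilityMeasure U := cond_isProbabilityMeasure_of_finite h𝒳0 h𝒳
  have hν : U.map T (Set.range T)ᶜ = 0 := by
    rw [Measure.map_apply hT hTc.measurableSet.compl]
    convert measure_empty (μ := U)
    ext x; simp
  have hcell : ∀ y, MeasurableSet (T ⁻¹' {y}) := fun y => hT (measurableSet_singleton y)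
  have hcover : ⋃ y ∈ Set.range T, T ⁻¹' {y} = Set.univ := by
    ext x; simp
  have hL : ∫⁻ x, g (T x - x) ∂U
      = ∑' y : Set.range T, ∫⁻ x in T ⁻¹' {(y : EuclideanSpace ℝ (Fin n))}, g (T x - x) ∂U := by
    rw [← lintegral_biUnion hTc (fun y _ => hcell y) _, hcover, Measure.restrict_univ]
    intro y _ y' _ hyy'
    exact Set.disjoint_left.2 fun x (hx : T x = y) (hx' : T x = y') => hyy' (hx ▸ hx')
  have hR := lintegral_countable (μ := U.map T) (fun y => min 1 (b * (U.map T {y})⁻¹)) hTc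
  have hrestr : (U.map T).restrict (Set.range T) = U.map T :=
    Measure.restrict_eq_self_of_ae_mem (mem_ae_iff.2 hν)
  rw [hrestr] at hR
  rw [hL, hR]
  refine ENNReal.tsum_le_tsum fun y => ?_
  have hp : U.map T {(y : EuclideanSpace ℝ (Fin n))} = U (T ⁻¹' {(y : EuclideanSpace ℝ (Fin n))}) :=
    Measure.map_apply hT (measurableSet_singleton _)
  rw [hp]
  set A := T ⁻¹' {(y : EuclideanSpace ℝ (Fin n))} with hA
  by_cases hA0 : U A = 0
  · simp [hA0, Measure.restrict_eq_zero.2 hA0]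
  have hAt : U A ≠ ∞ := measure_ne_top _ _
  -- With `p = U A`, the cell's share of the right side is `min 1 (b / p) * p = min p b`.
  rw [min_mul_of_nonneg _ _ zero_le, one_mul, mul_assoc, ENNReal.inv_mul_cancel hA0 hAt, mul_one]
  refine le_min ?_ ?_
  · calc ∫⁻ x in A, g (T x - x) ∂U ≤ ∫⁻ x in A, 1 ∂U := lintegral_mono fun x => hg1 _
      _ = U A := setLIntegral_one A
  · calc ∫⁻ x in A, g (T x - x) ∂U = ∫⁻ x in A, g (y - x) ∂U :=
          setLIntegral_congr_fun (hcell _) fun x (hx : T x = y) => by simp only [hx]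
      _ ≤ ∫⁻ x, g (y - x) ∂U := setLIntegral_le_lintegral _ _
      _ = (volume 𝒳)⁻¹ * ∫⁻ x in 𝒳, g (y - x) := by
          rw [hU, ProbabilityTheory.cond, lintegral_smul_measure, smul_eq_mul]
      _ ≤ (volume 𝒳)⁻¹ * ∫⁻ x, g (y - x) := by gcongr; exact Measure.restrict_le_self
      _ = (volume 𝒳)⁻¹ * ∫⁻ x, g x := by rw [lintegral_sub_left_eq_self]
      _ ≤ (volume 𝒳)⁻¹ * (b * volume 𝒳) := by gcongr
      _ = b := by rw [mul_left_comm, ENNReal.inv_mul_cancel h𝒳0 h𝒳, mul_one]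

/-- For a countably supported probability measure, the Shannon entropy in nats plus one dominates
the mean of `1 - log ν{y}`. -/
theorem lintegral_truncationIntegral_le_shannonEntropy {𝒴 : Type*} [MeasurableSpace 𝒴]
    [MeasurableSingletonClass 𝒴] (ν : Measure 𝒴) [IsProbabilityMeasure ν] {C : Set 𝒴}
    (hC : C.Countable) (hνC : ν Cᶜ = 0) :
    ∫⁻ y, truncationIntegral 1 (ν {y})⁻¹ ∂ν ≤
      ENNReal.ofReal (Real.log 2) * shannonEntropy ν + 1 := by
  have hrestr : ν.restrict C = ν :=
    Measure.restrict_eq_self_of_ae_mem (mem_ae_iff.2 hνC)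
  have hR := lintegral_countable (μ := ν) (fun y => truncationIntegral 1 (ν {y})⁻¹) hC
  rw [hrestr] at hR
  have hterm : ∀ y, truncationIntegral 1 (ν {y})⁻¹ * ν {y} =
      ENNReal.ofReal (Real.log 2) *
        ENNReal.ofReal (-(ν.real {y} * Real.logb 2 (ν.real {y}))) + ν {y} := by
    intro y
    have hp1 : ν.real {y} ≤ 1 := measureReal_le_one
    have hp : ν {y} = ENNReal.ofReal (ν.real {y}) := (ofReal_measureReal (measure_ne_top _ _)).symm
    rw [hp]
    rcases (measureReal_nonneg : 0 ≤ ν.real {y}).eq_or_lt with h0 | h0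
    · simp [← h0]
    generalize ν.real {y} = p at *
    have hlog : Real.log p ≤ 0 := Real.log_nonpos h0.le hp1
    have hl2 : 0 < Real.log 2 := Real.log_pos one_lt_two
    rw [← ENNReal.ofReal_inv_of_pos h0, truncationIntegral_one_le ((one_le_inv₀ h0).2 hp1),
      Real.log_inv, ← ENNReal.ofReal_mul (by linarith), ← ENNReal.ofReal_mul hl2.le,
      ← ENNReal.ofReal_add _ h0.le]
    · congr 1
      rw [Real.logb]
      field_simp
      ring
    · rw [Real.logb]
      have : p * (Real.log p / Real.log 2) ≤ 0 :=
        mul_nonpos_of_nonneg_of_nonpos h0.le (div_nonpos_of_nonpos_of_nonneg hlog hl2.le)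
      exact mul_nonneg hl2.le (by linarith)
  rw [hR, tsum_congr fun y : C => hterm y, ENNReal.tsum_add, ENNReal.tsum_mul_left]
  gcongr
  · rw [shannonEntropy, if_pos ⟨C, hC, hνC⟩]
    exact ENNReal.tsum_comp_le_tsum_of_injective Subtype.val_injective
      fun y => ENNReal.ofReal (-(ν.real {y} * Real.logb 2 (ν.real {y})))
  · have := lintegral_countable (μ := ν) (fun _ => 1) hC
    rw [hrestr] at this
    simp only [one_mul, lintegral_const, measure_univ] at this
    exact this.ge

/-! ### Averaging over the state -/

/-- The kernel sending a state to the output distribution of the quantizer. -/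
noncomputable def quantizerKernel {E 𝒮 : Type*} [MeasurableSpace E] [MeasurableSpace 𝒮]
    (U : Measure E) (Q : E → 𝒮 → E) : Kernel 𝒮 E :=
  (Kernel.id ×ₖ Kernel.const 𝒮 U).map fun p => Q p.2 p.1

theorem quantizerKernel_apply {E 𝒮 : Type*} [MeasurableSpace E] [MeasurableSpace 𝒮]
    (U : Measure E) [SFinite U] {Q : E → 𝒮 → E} (hQ : Measurable (Function.uncurry Q)) (s : 𝒮) :
    quantizerKernel U Q s = U.map fun x => Q x s := by
  have hQ' : Measurable fun p : 𝒮 × E => Q p.2 p.1 := hQ.comp measurable_swap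
  rw [quantizerKernel, Kernel.map_apply _ hQ', Kernel.prod_apply, Kernel.id_apply,
    Kernel.const_apply, Measure.dirac_prod, Measure.map_map hQ' measurable_prodMk_left]
  rfl

instance {E 𝒮 : Type*} [MeasurableSpace E] [MeasurableSpace 𝒮] (U : Measure E)
    [IsFiniteMeasure U] (Q : E → 𝒮 → E) : IsFiniteKernel (quantizerKernel U Q) := by
  unfold quantizerKernel; infer_instance

/-- Point masses are measures of sections of the diagonal, which is measurable. -/
theorem measurable_kernel_singleton {E 𝒮 : Type*} [MeasurableSpace E] [MeasurableSpace 𝒮]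
    [MeasurableEq E] (κ : Kernel 𝒮 E) [IsFiniteKernel κ] :
    Measurable fun p : 𝒮 × E => κ p.1 {p.2} := by
  have h := Kernel.measurable_kernel_prodMk_left (κ := κ.comap Prod.fst measurable_fst)
    (t := {q : (𝒮 × E) × E | q.2 = q.1.2})
    (measurableSet_eq_fun measurable_snd (measurable_snd.comp measurable_fst))
  exact h

theorem antitone_measure_superlevel {α : Type*} [MeasurableSpace α] (μ : Measure α) (f : α → ℝ) :
    Antitone fun t => μ {z | t ≤ f z} :=
  fun _ _ hst => measure_mono fun _ hz => hst.trans hz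

/-- The core inequality: the truncated layer-cake integral of the error density is at most the
conditional entropy in nats plus one. -/
theorem lintegral_truncationIntegral_superlevel_le {n : ℕ} {𝒮 : Type*} [MeasurableSpace 𝒮]
    (q : RandomizedQuantizer n 𝒮) {f : EuclideanSpace ℝ (Fin n) → ℝ} (hf : Measurable f)
    (hf0 : ∀ z, 0 ≤ f z) (hfi : ∫⁻ z, ENNReal.ofReal (f z) ≠ ∞)
    {𝒳 : Set (EuclideanSpace ℝ (Fin n))} (h𝒳0 : volume 𝒳 ≠ 0) (h𝒳 : volume 𝒳 ≠ ∞)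
    (herr : ((cond volume 𝒳).prod q.stateLaw).map (fun ω => q.quantize ω.1 ω.2 - ω.1)
      = volume.withDensity fun z => ENNReal.ofReal (f z)) :
    ∫⁻ t in Set.Ioi (0 : ℝ), truncationIntegral (volume {z | t ≤ f z}) (volume 𝒳) ≤
      ENNReal.ofReal (Real.log 2) *
        ∫⁻ s, shannonEntropy ((cond volume 𝒳).map fun x => q.quantize x s) ∂q.stateLaw + 1 := by
  set U : Measure (EuclideanSpace ℝ (Fin n)) := cond volume 𝒳 with hU
  have : IsProbabilityMeasure U := cond_isProbabilityMeasure_of_finite h𝒳0 h𝒳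
  set κ := quantizerKernel U q.quantize with hκ
  have hQ := q.measurable_quantize
  have hQs : ∀ s, Measurable fun x => q.quantize x s := fun s => hQ.comp measurable_prodMk_right
  have hκs : ∀ s, κ s = U.map fun x => q.quantize x s := quantizerKernel_apply U hQ
  have hprob : ∀ s, IsProbabilityMeasure (κ s) := fun s => by
    rw [hκs]; exact Measure.isProbabilityMeasure_map (hQs s).aemeasurable
  have hκm := measurable_kernel_singleton κ
  have hV : Measurable fun t : ℝ => volume {z | t ≤ f z} :=
    (antitone_measure_superlevel volume f).measurable
  have hstep : ∀ b ∈ Set.Ioc (0 : ℝ) 1,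
      ∫⁻ t in Set.Ioi (0 : ℝ), min (volume {z | t ≤ f z}) (ENNReal.ofReal b * volume 𝒳) ≤
        ∫⁻ p, min 1 (ENNReal.ofReal b * (κ p.1 {p.2})⁻¹) ∂(q.stateLaw ⊗ₘ κ) := by
    intro b hb
    obtain ⟨g, hg, hg1, hgb, hfg⟩ := exists_testFunction_lintegral_min_le volume hf hf0 hfi
      (a := ENNReal.ofReal b * volume 𝒳)
      (mul_ne_zero (by simpa using hb.1) h𝒳0)
    refine hfg.trans ?_
    have hsub : Measurable fun ω : EuclideanSpace ℝ (Fin n) × 𝒮 => q.quantize ω.1 ω.2 - ω.1 :=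
      hQ.sub measurable_fst
    have h1 : ∫⁻ z, ENNReal.ofReal (f z) * g z
        = ∫⁻ s, ∫⁻ x, g (q.quantize x s - x) ∂U ∂q.stateLaw := by
      rw [← lintegral_prod_symm (fun ω : EuclideanSpace ℝ (Fin n) × 𝒮 =>
          g (q.quantize ω.1 ω.2 - ω.1)) (hg.comp hsub).aemeasurable,
        ← lintegral_map hg hsub, herr, lintegral_withDensity_eq_lintegral_mul _ (by fun_prop) hg]
      rfl
    have hmin : Measurable fun p : 𝒮 × EuclideanSpace ℝ (Fin n) =>
        min 1 (ENNReal.ofReal b * (κ p.1 {p.2})⁻¹) := measurable_const.min (hκm.inv.const_mul _)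
    rw [h1, Measure.lintegral_compProd hmin]
    refine lintegral_mono fun s => ?_
    simp only [hκs]
    exact lintegral_comp_sub_le_lintegral_min h𝒳0 h𝒳 (hQs s) (q.countable_range s) hg1 hgb
  calc ∫⁻ t in Set.Ioi (0 : ℝ), truncationIntegral (volume {z | t ≤ f z}) (volume 𝒳)
      = ∫⁻ b in Set.Ioc (0 : ℝ) 1, ∫⁻ t in Set.Ioi (0 : ℝ),
          min (volume {z | t ≤ f z}) (ENNReal.ofReal b * volume 𝒳) * ENNReal.ofReal b⁻¹ := by
        simp only [truncationIntegral]
        rw [lintegral_lintegral_swap]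
        exact Measurable.aemeasurable
          (((hV.comp measurable_fst).min (by fun_prop)).mul (by fun_prop))
    _ ≤ ∫⁻ b in Set.Ioc (0 : ℝ) 1, ∫⁻ p,
          min 1 (ENNReal.ofReal b * (κ p.1 {p.2})⁻¹) * ENNReal.ofReal b⁻¹
            ∂(q.stateLaw ⊗ₘ κ) := by
        refine setLIntegral_mono' measurableSet_Ioc fun b hb => ?_
        rw [lintegral_mul_const' _ _ ENNReal.ofReal_ne_top,
          lintegral_mul_const' _ _ ENNReal.ofReal_ne_top]
        gcongr
        exact hstep b hb
    _ = ∫⁻ p, truncationIntegral 1 (κ p.1 {p.2})⁻¹ ∂(q.stateLaw ⊗ₘ κ) := by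
        simp only [truncationIntegral]
        rw [lintegral_lintegral_swap]
        exact Measurable.aemeasurable ((measurable_const.min (Measurable.mul (by fun_prop)
          (hκm.comp measurable_snd).inv)).mul (by fun_prop))
    _ = ∫⁻ s, ∫⁻ y, truncationIntegral 1 (κ s {y})⁻¹ ∂κ s ∂q.stateLaw := by
        refine Measure.lintegral_compProd ?_
        simp only [truncationIntegral]
        refine Measurable.lintegral_prod_right' (f := fun r : (𝒮 × _) × ℝ =>
          min 1 (ENNReal.ofReal r.2 * (κ r.1.1 {r.1.2})⁻¹) * ENNReal.ofReal r.2⁻¹) ?_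
        exact (measurable_const.min (Measurable.mul (by fun_prop)
          (hκm.comp measurable_fst).inv)).mul (by fun_prop)
    _ ≤ ∫⁻ s, (ENNReal.ofReal (Real.log 2) * shannonEntropy (U.map fun x => q.quantize x s) + 1)
          ∂q.stateLaw := by
        refine lintegral_mono fun s => ?_
        have := hprob s
        simp only [← hκs]
        refine lintegral_truncationIntegral_le_shannonEntropy (κ s) (q.countable_range s) ?_
        rw [hκs, Measure.map_apply (hQs s) (q.countable_range s).measurableSet.compl]
        convert measure_empty (μ := U)
        ext x; simp
    _ = _ := by
        rw [lintegral_add_right _ measurable_const, lintegral_const_mul' _ _ ENNReal.ofReal_ne_top]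
        simp

/-- By independence, the joint law of state and output disintegrates through the explicit kernel;
conditional distributions are almost everywhere unique. -/
theorem condShannonEntropy_eq_lintegral_map {n : ℕ} {Ω 𝒮 : Type*} [MeasurableSpace Ω]
    [MeasurableSpace 𝒮] (q : RandomizedQuantizer n 𝒮) (P : Measure Ω) [IsProbabilityMeasure P]
    {X : Ω → EuclideanSpace ℝ (Fin n)} {S : Ω → 𝒮} (hX : Measurable X) (hS : Measurable S)
    (hSq : P.map S = q.stateLaw) (hXS : IndepFun X S P) :
    condShannonEntropy (fun ω => q.quantize (X ω) (S ω)) S P =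
      ∫⁻ s, shannonEntropy ((P.map X).map fun x => q.quantize x s) ∂q.stateLaw := by
  have : IsProbabilityMeasure (P.map X) := Measure.isProbabilityMeasure_map hX.aemeasurable
  have hQ := q.measurable_quantize
  have hY : Measurable fun ω => q.quantize (X ω) (S ω) := hQ.comp (hX.prodMk hS)
  have hpair := (indepFun_iff_map_prod_eq_prod_map_map hX.aemeasurable hS.aemeasurable).1 hXS
  have hF : Measurable fun p : EuclideanSpace ℝ (Fin n) × 𝒮 => (p.2, q.quantize p.1 p.2) :=
    measurable_snd.prodMk hQ
  have hdis : P.map (fun ω => (S ω, q.quantize (X ω) (S ω))) =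
      P.map S ⊗ₘ quantizerKernel (P.map X) q.quantize := by
    have h1 : P.map (fun ω => (S ω, q.quantize (X ω) (S ω))) =
        ((P.map X).prod (P.map S)).map fun p => (p.2, q.quantize p.1 p.2) := by
      rw [← hpair, Measure.map_map hF (hX.prodMk hS)]
      rfl
    rw [h1, hSq]
    ext B hB
    rw [Measure.map_apply hF hB, Measure.prod_apply_symm (hF hB), Measure.compProd_apply hB]
    refine lintegral_congr fun s => ?_
    rw [quantizerKernel_apply _ hQ, Measure.map_apply (f := fun x => q.quantize x s)
      (hQ.comp measurable_prodMk_right) (measurable_prodMk_left hB)]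
    rfl
  have hae := condDistrib_ae_eq_of_measure_eq_compProd S hY.aemeasurable hdis
  rw [condShannonEntropy, ← hSq]
  refine lintegral_congr_ae ?_
  filter_upwards [hae] with s hs
  rw [hs, quantizerKernel_apply _ hQ]

/-! ### Layered entropy in the extended reals -/

/-- From the integrated truncation inequality in nats to the layered entropy bound in bits. -/
theorem logb_sub_layeredEntropy_le_of_lintegral_truncationIntegral_le {n : ℕ}
    {f : EuclideanSpace ℝ (Fin n) → ℝ} (hf : Measurable f)
    (hf0 : ∀ z, 0 ≤ f z) (hf1 : ∫⁻ z, ENNReal.ofReal (f z) = 1) {M : ℝ} (hM : 0 < M) {H : ℝ≥0∞}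
    (h : ∫⁻ t in Set.Ioi (0 : ℝ), truncationIntegral (volume {z | t ≤ f z}) (ENNReal.ofReal M) ≤
      ENNReal.ofReal (Real.log 2) * H + 1) :
    ((Real.logb 2 M : ℝ) : EReal) - layeredEntropy f ≤ (H : EReal) := by
  have hl2 : 0 < Real.log 2 := Real.log_pos one_lt_two
  set V : ℝ → ℝ := fun t => volume.real {z | t ≤ f z} with hVdef
  have hlayer : ∫⁻ t in Set.Ioi (0 : ℝ), volume {z | t ≤ f z} = 1 := by
    rw [← lintegral_eq_lintegral_meas_le _ (ae_of_all _ hf0) hf.aemeasurable, hf1]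
  have hVm : Measurable V := (antitone_measure_superlevel volume f).measurable.ennreal_toReal
  have hV0 : ∀ t, 0 ≤ V t := fun t => measureReal_nonneg
  have hfin : ∀ t, 0 < t → volume {z | t ≤ f z} = ENNReal.ofReal (V t) := by
    intro t ht
    refine (ofReal_measureReal (fun htop => ?_)).symm
    have h1 := mul_meas_ge_le_lintegral (μ := volume) (f := fun z => ENNReal.ofReal (f z))
      (by fun_prop) (ENNReal.ofReal t)
    have h2 : volume {z | t ≤ f z} ≤ volume {z | ENNReal.ofReal t ≤ ENNReal.ofReal (f z)} :=
      measure_mono fun z hz => ENNReal.ofReal_le_ofReal hz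
    rw [htop, top_le_iff] at h2
    rw [h2, hf1, ENNReal.mul_top (by simpa using ht)] at h1
    exact absurd h1 (by simp)
  have hVint : ∫⁻ t in Set.Ioi (0 : ℝ), ENNReal.ofReal (V t) = 1 := by
    rw [← hlayer]
    exact setLIntegral_congr_fun measurableSet_Ioi fun t ht => (hfin t ht).symm
  have hgm : Measurable (layeredIntegrand f) := hVm.mul (hVm.log.div_const _)
  set J : ℝ → ℝ≥0∞ := fun t => truncationIntegral (volume {z | t ≤ f z}) (ENNReal.ofReal M)
    with hJdef
  set p : ℝ≥0∞ := ∫⁻ t in Set.Ioi (0 : ℝ), ENNReal.ofReal (layeredIntegrand f t) with hp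
  set N : ℝ≥0∞ := ∫⁻ t in Set.Ioi (0 : ℝ), ENNReal.ofReal (-layeredIntegrand f t) with hN
  -- Adding `K * V t` to both sides makes the coefficient `1 + log M + K` nonnegative, so the
  -- estimates can be integrated in `ℝ≥0∞`.
  set K : ℝ := |Real.log M| with hK
  have hK0 : 0 ≤ K := abs_nonneg _
  have hKM : -K ≤ Real.log M := neg_abs_le _
  have hI : ∀ t, Real.log 2 * layeredIntegrand f t = V t * Real.log (V t) := by
    intro t
    rw [layeredIntegrand, Real.logb]
    field_simp
    rfl
  have hJ : ∀ t ∈ Set.Ioi (0 : ℝ),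
      ENNReal.ofReal (V t * (1 + (Real.log M - Real.log (V t)))) ≤ J t := by
    intro t ht
    simp only [hJdef, hfin t ht]
    exact ofReal_mul_log_div_le_truncationIntegral (hV0 t) hM
  by_cases hH : H = ∞
  · simp [hH]
  have hB : ENNReal.ofReal (Real.log 2) * H + 1 ≠ ∞ :=
    ENNReal.add_ne_top.2 ⟨ENNReal.mul_ne_top ENNReal.ofReal_ne_top hH, ENNReal.one_ne_top⟩
  -- Finite entropy excludes an infinite negative part, hence also the convention `⊤ - ⊤ = ⊥`.
  have hNfin : N ≠ ∞ := by
    have hle : ENNReal.ofReal (Real.log 2) * N ≤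
        (ENNReal.ofReal (Real.log 2) * H + 1) + ENNReal.ofReal K := by
      calc ENNReal.ofReal (Real.log 2) * N
          = ∫⁻ t in Set.Ioi (0 : ℝ),
              ENNReal.ofReal (Real.log 2) * ENNReal.ofReal (-layeredIntegrand f t) := by
            rw [lintegral_const_mul _ (by fun_prop)]
        _ ≤ ∫⁻ t in Set.Ioi (0 : ℝ), (J t + ENNReal.ofReal K * ENNReal.ofReal (V t)) := by
            refine setLIntegral_mono' measurableSet_Ioi fun t ht => ?_
            rw [← ENNReal.ofReal_mul hl2.le, ← ENNReal.ofReal_mul hK0]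
            refine le_trans ?_ (add_le_add_left (hJ t ht) _)
            refine le_trans (ENNReal.ofReal_le_ofReal ?_) ENNReal.ofReal_add_le
            have := mul_le_mul_of_nonneg_left hKM (hV0 t)
            nlinarith [hI t, hV0 t]
        _ ≤ _ := by
            rw [lintegral_add_right _ (by fun_prop), lintegral_const_mul _ (by fun_prop), hVint,
              mul_one]
            gcongr
    intro hNt
    rw [hNt, ENNReal.mul_top (by simpa using hl2), top_le_iff] at hle
    exact ENNReal.add_ne_top.2 ⟨hB, ENNReal.ofReal_ne_top⟩ hle
  by_cases hpfin : p = ∞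
  · have : layeredEntropy f = ⊤ := by
      rw [layeredEntropy, ← hp, ← hN, hpfin]
      clear_value N
      lift N to NNReal using hNfin
      rfl
    rw [this]
    simp
  have hle : ENNReal.ofReal (Real.log 2) * N + ENNReal.ofReal (1 + Real.log M + K) ≤
      (ENNReal.ofReal (Real.log 2) * H + 1) + ENNReal.ofReal (Real.log 2) * p
        + ENNReal.ofReal K := by
    calc ENNReal.ofReal (Real.log 2) * N + ENNReal.ofReal (1 + Real.log M + K)
        = ∫⁻ t in Set.Ioi (0 : ℝ), (ENNReal.ofReal (Real.log 2) *
            ENNReal.ofReal (-layeredIntegrand f t) +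
              ENNReal.ofReal (1 + Real.log M + K) * ENNReal.ofReal (V t)) := by
          rw [lintegral_add_right _ (by fun_prop), lintegral_const_mul _ (by fun_prop),
            lintegral_const_mul _ (by fun_prop), hVint, mul_one]
      _ ≤ ∫⁻ t in Set.Ioi (0 : ℝ), (J t + ENNReal.ofReal (Real.log 2) *
            ENNReal.ofReal (layeredIntegrand f t) + ENNReal.ofReal K * ENNReal.ofReal (V t)) := by
          refine setLIntegral_mono' measurableSet_Ioi fun t ht => ?_
          refine le_trans ?_ (add_le_add_left (add_le_add_left (hJ t ht) _) _)
          have hV := hV0 t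
          have hVK := mul_le_mul_of_nonneg_left hKM hV
          rw [← ENNReal.ofReal_mul hl2.le, ← ENNReal.ofReal_mul hl2.le, ← ENNReal.ofReal_mul hK0,
            ← ENNReal.ofReal_mul (by linarith), mul_neg, hI t]
          -- Only one of the positive and negative parts of `V log V` survives.
          rcases le_total 0 (V t * Real.log (V t)) with hs | hs
          · rw [ENNReal.ofReal_of_nonpos (by linarith : -(V t * Real.log (V t)) ≤ 0), zero_add]
            refine le_trans (ENNReal.ofReal_le_ofReal ?_)
              (ENNReal.ofReal_add_le.trans (add_le_add_left ENNReal.ofReal_add_le _))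
            nlinarith
          · rw [ENNReal.ofReal_of_nonpos hs, add_zero, ← ENNReal.ofReal_add (by linarith)
              (mul_nonneg (by linarith) hV)]
            refine le_trans (ENNReal.ofReal_le_ofReal ?_) ENNReal.ofReal_add_le
            nlinarith
      _ ≤ _ := by
          rw [lintegral_add_right _ (by fun_prop), lintegral_add_right _ (by fun_prop),
            lintegral_const_mul _ (by fun_prop), lintegral_const_mul _ (by fun_prop), hVint,
            mul_one]
          gcongr
  rw [layeredEntropy, ← hp, ← hN]
  clear_value p N
  lift N to NNReal using hNfin
  lift p to NNReal using hpfin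
  lift H to NNReal using hH
  have hreal : Real.log 2 * N + (1 + Real.log M + K) ≤
      (Real.log 2 * H + 1) + Real.log 2 * p + K := by
    have hr := ENNReal.toReal_mono (by finiteness) hle
    rw [ENNReal.toReal_add (by finiteness) (by finiteness),
      ENNReal.toReal_add (by finiteness) (by finiteness),
      ENNReal.toReal_add (by finiteness) (by finiteness),
      ENNReal.toReal_add (by finiteness) (by finiteness)] at hr
    simpa [ENNReal.toReal_mul, ENNReal.toReal_ofReal, hl2.le, hK0,
      show 0 ≤ 1 + Real.log M + K by linarith] using hr
  have hfinal : Real.logb 2 M - ((p : ℝ) - N) ≤ H := by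
    have hlog : Real.log M = Real.log 2 * Real.logb 2 M := by
      rw [Real.logb]; field_simp
    rw [hlog] at hreal
    refine le_of_mul_le_mul_left ?_ hl2
    linarith
  rw [EReal.coe_nnreal_eq_coe_real, EReal.coe_nnreal_eq_coe_real, EReal.coe_nnreal_eq_coe_real]
  exact_mod_cast hfinal

/-! ### Entropy bounds for quantizers -/

/-- The entropy bound for a uniform input that is independent of the state. -/
theorem logb_sub_layeredEntropy_le_condShannonEntropy {n : ℕ} {Ω 𝒮 : Type*} [MeasurableSpace Ω]
    [MeasurableSpace 𝒮] (q : RandomizedQuantizer n 𝒮) {f : EuclideanSpace ℝ (Fin n) → ℝ}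
    (hf : Measurable f) (hf0 : ∀ z, 0 ≤ f z) (P : Measure Ω) [IsProbabilityMeasure P]
    {X : Ω → EuclideanSpace ℝ (Fin n)} {S : Ω → 𝒮} {𝒳 : Set (EuclideanSpace ℝ (Fin n))}
    (hX : Measurable X) (hS : Measurable S) (h𝒳0 : 0 < volume 𝒳) (h𝒳 : volume 𝒳 < ∞)
    (hXu : pdf.IsUniform X 𝒳 P volume) (hSq : P.map S = q.stateLaw) (hXS : IndepFun X S P)
    (herr : P.map (fun ω => q.quantize (X ω) (S ω) - X ω)
      = volume.withDensity fun z => ENNReal.ofReal (f z)) :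
    ((Real.logb 2 (volume.real 𝒳) : ℝ) : EReal) - layeredEntropy f
      ≤ ((condShannonEntropy (fun ω => q.quantize (X ω) (S ω)) S P : ℝ≥0∞) : EReal) := by
  have hQ := q.measurable_quantize
  have hsub : Measurable fun ω : EuclideanSpace ℝ (Fin n) × 𝒮 => q.quantize ω.1 ω.2 - ω.1 :=
    hQ.sub measurable_fst
  have hf1 : ∫⁻ z, ENNReal.ofReal (f z) = 1 := by
    have := congrArg (fun ν => ν Set.univ) herr
    simp only [withDensity_apply _ MeasurableSet.univ, Measure.restrict_univ] at this
    rw [← this]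
    have : IsProbabilityMeasure (P.map fun ω => q.quantize (X ω) (S ω) - X ω) :=
      Measure.isProbabilityMeasure_map (hsub.comp (hX.prodMk hS)).aemeasurable
    exact measure_univ
  have hXu' : P.map X = ProbabilityTheory.cond volume 𝒳 := hXu
  rw [condShannonEntropy_eq_lintegral_map q P hX hS hSq hXS, hXu']
  refine logb_sub_layeredEntropy_le_of_lintegral_truncationIntegral_le hf hf0 hf1
    (ENNReal.toReal_pos h𝒳0.ne' h𝒳.ne) ?_
  rw [ENNReal.ofReal_toReal h𝒳.ne]
  refine lintegral_truncationIntegral_superlevel_le q hf hf0 (by simp [hf1]) h𝒳0.ne' h𝒳.ne ?_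
  rw [← herr, ← hXu', ← hSq,
    ← (indepFun_iff_map_prod_eq_prod_map_map hX.aemeasurable hS.aemeasurable).1 hXS,
    Measure.map_map hsub (hX.prodMk hS)]
  rfl

theorem mainTheorem3 {n : ℕ} {𝒮 : Type*} [MeasurableSpace 𝒮] (q : RandomizedQuantizer n 𝒮)
    (f : EuclideanSpace ℝ (Fin n) → ℝ) (hf : Measurable f) (hf0 : ∀ z, 0 ≤ f z) :
    (∀ {Ω : Type*} [MeasurableSpace Ω] (P : Measure Ω) [IsProbabilityMeasure P]
      (X : Ω → EuclideanSpace ℝ (Fin n)) (S : Ω → 𝒮) (𝒳 : Set (EuclideanSpace ℝ (Fin n))),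
      Measurable X → Measurable S →
      MeasurableSet 𝒳 → 0 < volume 𝒳 → volume 𝒳 < ∞ →
      pdf.IsUniform X 𝒳 P volume → P.map S = q.stateLaw → IndepFun X S P →
      P.map (fun ω => q.quantize (X ω) (S ω) - X ω)
        = volume.withDensity (fun z => ENNReal.ofReal (f z)) →
      ((Real.logb 2 (volume.real 𝒳) : ℝ) : EReal) - layeredEntropy f
        ≤ ((condShannonEntropy (fun ω => q.quantize (X ω) (S ω)) S P : ℝ≥0∞) : EReal)) ∧
    ((∀ x : EuclideanSpace ℝ (Fin n),
      q.stateLaw.map (fun s => q.quantize x s - x)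
        = volume.withDensity (fun z => ENNReal.ofReal (f z))) →
      -layeredEntropy f ≤ q.normalizedEntropy) := by
  refine ⟨fun P _ X S 𝒳 hX hS _ h0 h1 hXu hSq hXS herr =>
    logb_sub_layeredEntropy_le_condShannonEntropy q hf hf0 P hX hS h0 h1 hXu hSq hXS herr,
    fun herr => ?_⟩
  have hev : ∀ᶠ τ : ℝ in atTop, -layeredEntropy f ≤ ((q.ballEntropy τ : ℝ≥0∞) : EReal) -
      ((Real.logb 2 (volume.real
        (Metric.closedBall (0 : EuclideanSpace ℝ (Fin n)) τ)) : ℝ) : EReal) := by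
    filter_upwards [eventually_gt_atTop (0 : ℝ)] with τ hτ
    have h0 : 0 < volume (Metric.closedBall (0 : EuclideanSpace ℝ (Fin n)) τ) :=
      Metric.measure_closedBall_pos _ _ hτ
    have h1 : volume (Metric.closedBall (0 : EuclideanSpace ℝ (Fin n)) τ) < ∞ :=
      measure_closedBall_lt_top
    set U := ProbabilityTheory.cond volume (Metric.closedBall (0 : EuclideanSpace ℝ (Fin n)) τ)
      with hU
    have : IsProbabilityMeasure U := cond_isProbabilityMeasure_of_finite h0.ne' h1.ne
    have hsub : Measurable fun ω : EuclideanSpace ℝ (Fin n) × 𝒮 => q.quantize ω.1 ω.2 - ω.1 :=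
      q.measurable_quantize.sub measurable_fst
    -- The error law is the same for every fixed input, so averaging over the input preserves it.
    have hlaw : (U.prod q.stateLaw).map (fun ω => q.quantize ω.1 ω.2 - ω.1)
        = volume.withDensity fun z => ENNReal.ofReal (f z) := by
      ext B hB
      rw [Measure.map_apply hsub hB, Measure.prod_apply (hsub hB)]
      have : ∀ x, q.stateLaw (Prod.mk x ⁻¹'
          ((fun ω : EuclideanSpace ℝ (Fin n) × 𝒮 => q.quantize ω.1 ω.2 - ω.1) ⁻¹' B)) =
          (volume.withDensity fun z => ENNReal.ofReal (f z)) B := by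
        intro x
        rw [← herr x, Measure.map_apply (f := fun s => q.quantize x s - x)
          (hsub.comp measurable_prodMk_left) hB]
        rfl
      simp [this]
    have key := logb_sub_layeredEntropy_le_condShannonEntropy q hf hf0 (U.prod q.stateLaw)
      (X := Prod.fst) (S := Prod.snd) measurable_fst measurable_snd h0 h1
      (show (U.prod q.stateLaw).map Prod.fst = U by simp) (by simp)
      (indepFun_prod measurable_id measurable_id) hlaw
    rw [EReal.le_sub_iff_add_le (.inl (EReal.coe_ne_bot _)) (.inl (EReal.coe_ne_top _)), add_comm]
    exact key
  exact le_limsup_of_frequently_le hev.frequently
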